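/- Consider the following 2-user opportunistic scheduling system in slotted time $t\in\{0,1,2,\dots\}$. The states $S[0],S[1],\dots$ are i.i.d. with $P[S[t]=1]=q$ and $P[S[t]=0]=1-q$. On every slot $t$ a rate vector $X[t]=(X_1[t],X_2[t])$ must be chosen from the decision set $\mathcal D(S[t])$, where $\mathcal D(0)=\{(1,0)\}$ and $\mathcal D(1)=\{(r,1-r^2): r\in[0,1]\}$. Let $\phi(x_1,x_2)=\log(1+x_1)+\log(1+x_2)$ and $\overline X_i(T)=\frac1T\sum_{t=0}^{T-1}X_i[t]$. Let $\phi^*=\phi^*(q)$ be the supremum of $\liminf_{T\to\infty}\phi\big(\mathbb E[\overline X_1(T)],\mathbb E[\overline X_2(T)]\big)$ over all algorithms that produce random vectors $X[t]\in\mathcal D(S[t])$ for all $t$, including randomized and non-causal algorithms and algorithms that know $q$. A (possibly randomized) statistics-unaware algorithm chooses each $X[t]\in\mathcal D(S[t])$ as a measurable function, not depending on $q$, of the observed states $S[0],\dots,S[t]$ and of a random seed that is independent of the states and whose law does not depend on $q$. 1. There is an absolute constant $c>0$ such that for every statistics-unaware algorithm there is a $q\in[1/4,3/4]$ with $$\phi\big(\mathbb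 E[\overline X_1(T)],\mathbb E[\overline X_2(T)]\big)\le \phi^*-c\,\frac{\log T}{T}\qquad\text{for all } T\in\{1,2,3,\dots\}.$$ 2. For every statistics-unaware algorithm there is a measurable set $\mathcal Q\subseteq[1/4,3/4]$ of Lebesgue measure at least $1/6$ such that for every $q\in\mathcal Q$ $$\limsup_{T\to\infty}\frac{T\phi^*-T\phi\big(\mathbb E[\overline X_1(T)],\mathbb E[\overline X_2(T)]\big)}{\log T}\ge\frac{3\beta^2}{2^{13}},\qquad \beta=\frac23-\frac{\sqrt7}{6},$$ where the limsup may be $+\infty$. -/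

import Mathlib

open MeasureTheory ProbabilityTheory Filter

namespace OpportunisticScheduling

/-- The decision set `𝒟(s)` of the 2-user system; the state `S[t] = 1` is `true` and `S[t] = 0`
is `false`. -/
def decisionSet : Bool → Set (ℝ × ℝ)
  | false => {((1 : ℝ), (0 : ℝ))}
  | true => {x | ∃ r : ℝ, 0 ≤ r ∧ r ≤ 1 ∧ x = (r, 1 - r ^ 2)}

/-- The utility function `φ(x₁, x₂) = log (1 + x₁) + log (1 + x₂)`. -/
noncomputable def utility (x₁ x₂ : ℝ) : ℝ := Real.log (1 + x₁) + Real.log (1 + x₂)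

section Processes

variable {Ω : Type*} [MeasurableSpace Ω]

/-- The states `S[0], S[1], …` are i.i.d. with `P[S[t] = 1] = q` and `P[S[t] = 0] = 1 - q`. -/
structure IsBernoulliProcess (q : unitInterval) (P : Measure Ω) (S : ℕ → Ω → Bool) : Prop where
  measurable : ∀ t, Measurable (S t)
  indep : iIndepFun S P
  law : ∀ t, P.map (S t) = bernoulliMeasure true false q

/-- The time average `X̄(T) = (1 / T) ∑_{t < T} X[t]` of the chosen rate vectors. -/
noncomputable def timeAverage (X : ℕ → Ω → ℝ × ℝ) (T : ℕ) (ω : Ω) : ℝ × ℝ :=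
  (1 / (T : ℝ)) • ∑ t ∈ Finset.range T, X t ω

/-- `φ(E[X̄₁(T)], E[X̄₂(T)])`. -/
noncomputable def expectedUtility (P : Measure Ω) (X : ℕ → Ω → ℝ × ℝ) (T : ℕ) : ℝ :=
  utility (∫ ω, (timeAverage X T ω).1 ∂P) (∫ ω, (timeAverage X T ω).2 ∂P)

end Processes

/-- The values `liminf_{T → ∞} φ(E[X̄(T)])` of all algorithms satisfying `X[t] ∈ 𝒟(S[t])` for
all `t`. The only other restriction on `X[t]` is measurability, so the algorithm may be randomized,
non-causal and may know `q`. -/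
def attainableUtilities (q : unitInterval) : Set ℝ :=
  {v | ∃ (Ω : Type) (_ : MeasurableSpace Ω) (P : Measure Ω) (_ : IsProbabilityMeasure P)
      (S : ℕ → Ω → Bool) (X : ℕ → Ω → ℝ × ℝ),
      IsBernoulliProcess q P S ∧ (∀ t, Measurable (X t)) ∧
      (∀ t ω, X t ω ∈ decisionSet (S t ω)) ∧
      v = liminf (fun T : ℕ => expectedUtility P X T) atTop}

/-- The optimal utility `φ*` of the system with `P[S[t] = 1] = q`. -/
noncomputable def optimalUtility (q : unitInterval) : ℝ := sSup (attainableUtilities q)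

/-- A (possibly randomized) statistics-unaware algorithm with random seeds in `U`: at every slot
`t` it chooses a vector in `𝒟(S[t])` as a measurable function of the seed and of the states
`S[0], …, S[t]` observed so far. -/
structure Algorithm (U : Type*) [MeasurableSpace U] where
  decide : (t : ℕ) → U → (Fin (t + 1) → Bool) → ℝ × ℝ
  measurable_decide : ∀ t, Measurable fun p : U × (Fin (t + 1) → Bool) => decide t p.1 p.2
  decide_mem : ∀ t u s, decide t u s ∈ decisionSet (s (Fin.last t))

section Runs

variable {U : Type*} [MeasurableSpace U]

/-- The joint law of the seed, with law `ν`, and of an independent i.i.d. state sequence with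
`P[S[t] = 1] = q`. -/
noncomputable def systemLaw (ν : Measure U) (q : unitInterval) : Measure (U × (ℕ → Bool)) :=
  ν.prod (Measure.infinitePi fun _ : ℕ => bernoulliMeasure true false q)

/-- The rate vectors `X[t]` chosen by the algorithm, as functions of the seed and the states. -/
def Algorithm.rates (A : Algorithm U) (t : ℕ) (ω : U × (ℕ → Bool)) : ℝ × ℝ :=
  A.decide t ω.1 fun i => ω.2 i

/-- `φ(E[X̄₁(T)], E[X̄₂(T)])` when the algorithm is run with seed law `ν` and
`P[S[t] = 1] = q`. -/
noncomputable def Algorithm.performance (A : Algorithm U) (ν : Measure U) (q : unitInterval)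
    (T : ℕ) : ℝ :=
  expectedUtility (systemLaw ν q) A.rates T

end Runs

end OpportunisticScheduling

namespace OpportunisticScheduling

/-! Choosing a good rate on slot t amounts to estimating `optimalRate q` from t Bernoulli samples.
The mean squared error of such an estimate is typically at least of order 1/t, and these errors add
up to order log T.

Reduction to estimation: the constant rate `optimalRate q` bounds φ* from below. The tangent
inequality for the concave φ at this point, together with stationarity of the rate, bounds the
utility gap below by 1/5 of the average `risk` (`utility_gap`, `Algorithm.sum_risk_le`).

Two points: for q < q' the laws of the first t states have Bhattacharyya affinity at least 1 - t(q'
- q)², while the optimal rates differ by at least (q' - q)/4. Hence no decision rule has small risk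
at both parameters (`Algorithm.twoPointBound_risk`).

From pairs to a single q: the two-point bound leaves open which parameter is bad, and this may
change with t. For part 1, a nested sequence of intervals is chosen, one per epoch 9^(k-1) ≤ t <
9^k, so that their common point is bad in every epoch (`TwoPointBound.exists_log_le_sum`). For part
2, the bound is integrated over pairs q, q + 1/(2√t) inside a set of supposedly good parameters
(`TwoPointBound.le_setIntegral`); if that set has measure above 1/3, its integrated risk is too
large. -/

/-! ### A single bad parameter by nested intervals -/

/-- The two-point lower bound for a family of nonnegative risks `M t q`, `q ∈ [1/4, 3/4]`. -/
def TwoPointBound (M : ℕ → ℝ → ℝ) : Prop :=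
  ∀ t q q', 1 / 4 ≤ q → q < q' → q' ≤ 3 / 4 →
    (q' - q) ^ 2 / 16 * (1 / 2 - t * (q' - q) ^ 2) ≤ M t q + M t q'

/-- In this epoch t(q' - q)² ≤ 1/4, so each slot contributes at least (q' - q)²/64. There are at
least (8/9)·9^k slots and 9^k(q' - q)² ≥ 1/36. Truncated division makes the epoch k = 0 the single
slot 0. -/
theorem TwoPointBound.epoch_sum {M : ℕ → ℝ → ℝ} (hM : TwoPointBound M) (k : ℕ) {q q' : ℝ}
    (hq : 1 / 4 ≤ q) (hq' : q' ≤ 3 / 4) (h1 : 1 / 2 / 3 ^ (k + 1) ≤ q' - q)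
    (h2 : q' - q ≤ 1 / 2 / 3 ^ k) :
    1 / 2592 ≤ ∑ t ∈ Finset.Ico (9 ^ k / 9) (9 ^ k), (M t q + M t q') := by
  have h3 : (0 : ℝ) < 3 ^ k := by positivity
  have hd : 0 < q' - q := lt_of_lt_of_le (by positivity) h1
  have h9 : (9 : ℝ) ^ k = (3 ^ k) ^ 2 := by rw [← pow_mul, mul_comm, pow_mul]; norm_num
  have hlow : (1 : ℝ) / 36 ≤ 9 ^ k * (q' - q) ^ 2 := by
    have : (1 : ℝ) / 6 ≤ 3 ^ k * (q' - q) := by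
      rw [pow_succ, div_le_iff₀ (by positivity)] at h1
      linarith
    rw [h9, ← mul_pow]; nlinarith
  have hup : 9 ^ k * (q' - q) ^ 2 ≤ (1 : ℝ) / 4 := by
    have : 3 ^ k * (q' - q) ≤ (1 : ℝ) / 2 := by
      rw [le_div_iff₀ (by positivity)] at h2
      linarith
    have h0 : 0 ≤ 3 ^ k * (q' - q) := by positivity
    rw [h9, ← mul_pow]; nlinarith
  have hterm : ∀ t ∈ Finset.Ico (9 ^ k / 9) (9 ^ k),
      (q' - q) ^ 2 / 64 ≤ M t q + M t q' := by
    intro t ht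
    refine le_trans ?_ (hM t q q' hq (by linarith) hq')
    have ht' : (t : ℝ) ≤ 9 ^ k := by exact_mod_cast (Finset.mem_Ico.1 ht).2.le
    have : (t : ℝ) * (q' - q) ^ 2 ≤ 1 / 4 :=
      (mul_le_mul_of_nonneg_right ht' (sq_nonneg _)).trans hup
    nlinarith [sq_nonneg (q' - q)]
  refine le_trans ?_ (Finset.card_nsmul_le_sum _ _ _ hterm)
  rw [Nat.card_Ico, nsmul_eq_mul, Nat.cast_sub (Nat.div_le_self _ _)]
  have hdiv : ((9 ^ k / 9 : ℕ) : ℝ) ≤ 9 ^ k / 9 := by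
    simpa using (Nat.cast_div_le (α := ℝ) (m := 9 ^ k) (n := 9))
  have : (8 / 9 : ℝ) * 9 ^ k ≤ ((9 ^ k : ℕ) : ℝ) - ((9 ^ k / 9 : ℕ) : ℝ) := by
    push_cast at *; linarith
  have := mul_le_mul_of_nonneg_right this (by positivity : 0 ≤ (q' - q) ^ 2 / 64)
  linarith

/-- One of the two outer thirds works: otherwise each contains a parameter with a small epoch sum,
and these two parameters are at least one third of the length apart, against `epoch_sum`. -/
theorem TwoPointBound.exists_subinterval {M : ℕ → ℝ → ℝ} (hM : TwoPointBound M) (k : ℕ) {a : ℝ}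
    (ha : 1 / 4 ≤ a) (ha' : a + 1 / 2 / 3 ^ k ≤ 3 / 4) :
    ∃ a', a ≤ a' ∧ a' + 1 / 2 / 3 ^ (k + 1) ≤ a + 1 / 2 / 3 ^ k ∧
      ∀ q ∈ Set.Icc a' (a' + 1 / 2 / 3 ^ (k + 1)),
        1 / 5184 ≤ ∑ t ∈ Finset.Ico (9 ^ k / 9) (9 ^ k), M t q := by
  have hℓ : (0 : ℝ) < 1 / 2 / 3 ^ (k + 1) := by positivity
  have hs : (1 : ℝ) / 2 / 3 ^ k = 3 * (1 / 2 / 3 ^ (k + 1)) := by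
    rw [pow_succ]; field_simp
  by_contra! hcon
  obtain ⟨q, hq, hqs⟩ := hcon a le_rfl (by linarith)
  obtain ⟨q', hq', hqs'⟩ := hcon (a + 2 * (1 / 2 / 3 ^ (k + 1))) (by linarith) (by linarith)
  have := hM.epoch_sum k (q := q) (q' := q') (by linarith [hq.1]) (by linarith [hq'.2])
    (by linarith [hq.2, hq'.1]) (by linarith [hq.1, hq'.2])
  rw [Finset.sum_add_distrib] at this
  linarith

theorem TwoPointBound.exists_log_le_sum {M : ℕ → ℝ → ℝ} (hM : TwoPointBound M)
    (hM0 : ∀ t, ∀ q ∈ Set.Icc (1 / 4 : ℝ) (3 / 4), 0 ≤ M t q) :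
    ∃ q ∈ Set.Icc (1 / 4 : ℝ) (3 / 4), ∀ T : ℕ, 1 ≤ T →
      1 / 15552 * Real.log T ≤ ∑ t ∈ Finset.range T, M t q := by
  choose! f hf1 hf2 hf3 using fun (k : ℕ) (a : ℝ) (h : 1 / 4 ≤ a ∧ a + 1 / 2 / 3 ^ k ≤ 3 / 4) =>
    hM.exists_subinterval k h.1 h.2
  let a : ℕ → ℝ := fun n => Nat.rec (1 / 4) (fun k x => f k x) n
  have ha : ∀ k, 1 / 4 ≤ a k ∧ a k + 1 / 2 / 3 ^ k ≤ 3 / 4 := by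
    intro k
    induction k with
    | zero => norm_num [a]
    | succ k ih => exact ⟨ih.1.trans (hf1 k _ ih), (hf2 k _ ih).trans ih.2⟩
  have hanti : Antitone fun k => Set.Icc (a k) (a k + 1 / 2 / 3 ^ k) :=
    antitone_nat_of_succ_le fun k => Set.Icc_subset_Icc (hf1 k _ (ha k)) (hf2 k _ (ha k))
  -- The supremum of the left endpoints lies in all the nested intervals, so it is bad in every
  -- epoch at once.
  have hmem := ciSup_mem_iInter_Icc_of_antitone_Icc hanti
    (fun k => by have : (0 : ℝ) < 1 / 2 / 3 ^ k := by positivity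
                 linarith)
  set q := ⨆ n, a n
  rw [Set.mem_iInter] at hmem
  have hqI : q ∈ Set.Icc (1 / 4 : ℝ) (3 / 4) :=
    ⟨(ha 0).1.trans (hmem 0).1, (hmem 0).2.trans (ha 0).2⟩
  refine ⟨q, hqI, fun T hT => ?_⟩
  have hsum : ∀ k : ℕ, ((k : ℝ) + 1) / 5184 ≤ ∑ t ∈ Finset.range (9 ^ k), M t q := by
    intro k
    induction k with
    | zero => simpa using hf3 0 _ (ha 0) q (hmem 1)
    | succ k ih =>
      have h := hf3 (k + 1) _ (ha (k + 1)) q (hmem (k + 2))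
      have h9 : 9 ^ (k + 1) / 9 = 9 ^ k := by rw [pow_succ]; simp
      rw [h9] at h
      rw [← Finset.sum_range_add_sum_Ico _ (Nat.pow_le_pow_right (by norm_num) k.le_succ)]
      push_cast
      linarith
  -- Each epoch raises log T by log 9 ≤ 3, whence 15552 = 3 · 5184.
  have hlog9 : Real.log 9 ≤ 3 := by
    have h3 : Real.log 3 ≤ 1.5 := by
      have := Real.log_three_lt_d9
      norm_num at this ⊢; linarith
    have : Real.log 9 = 2 * Real.log 3 := by
      rw [← Real.log_rpow (by norm_num)]; norm_num
    linarith
  have hTlt : (T : ℝ) ≤ 9 ^ (Nat.log 9 T + 1) := by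
    exact_mod_cast (Nat.lt_pow_succ_log_self (by norm_num) T).le
  have hlogT : Real.log T ≤ ((Nat.log 9 T : ℝ) + 1) * 3 := by
    calc Real.log T ≤ Real.log (9 ^ (Nat.log 9 T + 1)) :=
          Real.log_le_log (by exact_mod_cast hT) hTlt
      _ = ((Nat.log 9 T : ℝ) + 1) * Real.log 9 := by rw [Real.log_pow]; push_cast; ring
      _ ≤ _ := by gcongr
  calc 1 / 15552 * Real.log T ≤ ((Nat.log 9 T : ℝ) + 1) / 5184 := by linarith
    _ ≤ _ := hsum _
    _ ≤ _ := Finset.sum_le_sum_of_subset_of_nonneg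
        (Finset.range_subset_range.2 (Nat.pow_log_le_self 9 (by omega))) fun t _ _ => hM0 t q hqI

/-! ### A bad set of positive measure by integration over shifted pairs -/

theorem log_le_sum_Ico_inv {m n : ℕ} (hm : 0 < m) (hmn : m ≤ n) :
    Real.log n - Real.log m ≤ ∑ t ∈ Finset.Ico m n, (1 : ℝ) / t := by
  induction n, hmn using Nat.le_induction with
  | base => simp
  | succ n hmn ih =>
    rw [Finset.sum_Ico_succ_top hmn]
    have hn : (0 : ℝ) < n := by exact_mod_cast hm.trans_le hmn
    have h := Real.log_le_sub_one_of_pos (x := ((n : ℝ) + 1) / n) (by positivity)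
    rw [Real.log_div (by positivity) (by positivity)] at h
    have : ((n : ℝ) + 1) / n - 1 = 1 / n := by field_simp; ring
    push_cast
    linarith

/-- Inclusion-exclusion: B and its translate both lie in an interval of length 1/2 + ε, and their
measures sum to at least 2/3. -/
theorem le_volume_real_inter_preimage_add {B : Set ℝ} (hB : MeasurableSet B)
    (hBI : B ⊆ Set.Icc (1 / 4 : ℝ) (3 / 4)) (hvol : 1 / 3 ≤ volume.real B) {ε : ℝ} (hε : 0 ≤ ε) :
    1 / 6 - ε ≤ volume.real (B ∩ (fun x => x + ε) ⁻¹' B) := by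
  have hfin : volume B ≠ ⊤ := ((measure_mono hBI).trans_lt (by simp)).ne
  have hmeas : MeasurableSet ((fun x => x + ε) ⁻¹' B) := measurable_add_const ε hB
  have hshift : volume ((fun x => x + ε) ⁻¹' B) = volume B := measure_preimage_add_right _ _ _
  have h := measureReal_union_add_inter (μ := volume) (s := B) hmeas hfin (by rwa [hshift])
  have hr : volume.real ((fun x => x + ε) ⁻¹' B) = volume.real B := by
    simp only [measureReal_def, hshift]
  have hu : volume.real (B ∪ (fun x => x + ε) ⁻¹' B) ≤ 1 / 2 + ε := by
    calc _ ≤ volume.real (Set.Icc (1 / 4 - ε) (3 / 4 : ℝ)) := by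
          refine measureReal_mono ?_ (by simp)
          rintro x (hx | hx)
          · exact ⟨by linarith [(hBI hx).1], (hBI hx).2⟩
          · have := hBI hx
            exact ⟨by linarith [this.1], by linarith [this.2]⟩
      _ = 1 / 2 + ε := by
          rw [Real.volume_real_Icc_of_le (by linarith)]; ring
  linarith

theorem TwoPointBound.le_setIntegral {M : ℕ → ℝ → ℝ} (hM : TwoPointBound M)
    (hM0 : ∀ t, ∀ q ∈ Set.Icc (1 / 4 : ℝ) (3 / 4), 0 ≤ M t q)
    (hint : ∀ t, IntegrableOn (M t) (Set.Icc (1 / 4 : ℝ) (3 / 4)))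
    {B : Set ℝ} (hB : MeasurableSet B) (hBI : B ⊆ Set.Icc (1 / 4 : ℝ) (3 / 4))
    (hvol : 1 / 3 ≤ volume.real B) {t : ℕ} (ht : 36 ≤ t) :
    1 / 6144 * (1 / (t : ℝ)) ≤ ∫ q in B, M t q := by
  have ht0 : (36 : ℝ) ≤ t := by exact_mod_cast ht
  have hst : 6 ≤ √(t : ℝ) := Real.le_sqrt_of_sq_le (by linarith)
  have hsq : √(t : ℝ) ^ 2 = t := Real.sq_sqrt (by linarith)
  -- This shift gives tε² = 1/4, and t ≥ 36 gives ε ≤ 1/12, so the pairs inside B retain measure at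
  -- least 1/12.
  set ε : ℝ := 1 / (2 * √t) with hεdef
  have hε : 0 < ε := by positivity
  have hε12 : ε ≤ 1 / 12 := by
    rw [hεdef]; apply one_div_le_one_div_of_le <;> linarith
  have hε2 : ε ^ 2 = 1 / (4 * t) := by rw [hεdef, div_pow, mul_pow, hsq]; norm_num
  have hmp := measurePreserving_add_right (volume : Measure ℝ) ε
  have hemb : MeasurableEmbedding (fun x : ℝ => x + ε) := measurableEmbedding_addRight ε
  set C := B ∩ (fun x => x + ε) ⁻¹' B with hC
  have hpm : MeasurableSet ((fun x => x + ε) ⁻¹' B) := measurable_add_const ε hB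
  have hCm : MeasurableSet C := hB.inter hpm
  have hBint : IntegrableOn (M t) B := (hint t).mono_set hBI
  have hPint : IntegrableOn (fun q => M t (q + ε)) ((fun x => x + ε) ⁻¹' B) :=
    (hmp.integrableOn_comp_preimage hemb).2 hBint
  have h1 : ∫ q in C, M t q ≤ ∫ q in B, M t q :=
    setIntegral_mono_set hBint
      ((ae_restrict_iff' hB).2 (ae_of_all _ fun q hq => hM0 t q (hBI hq)))
      (Set.inter_subset_left.eventuallyLE)
  have h2 : ∫ q in C, M t (q + ε) ≤ ∫ q in B, M t q := by
    rw [← hmp.setIntegral_preimage_emb hemb (M t) B]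
    exact setIntegral_mono_set hPint
      ((ae_restrict_iff' hpm).2 (ae_of_all _ fun q hq => hM0 t _ (hBI hq)))
      (Set.inter_subset_right.eventuallyLE)
  have hCfin : volume C ≠ ⊤ :=
    ((measure_mono (Set.inter_subset_left.trans hBI)).trans_lt (by simp)).ne
  have hi1 : IntegrableOn (M t) C := hBint.mono_set Set.inter_subset_left
  have hi2 : IntegrableOn (fun q => M t (q + ε)) C := hPint.mono_set Set.inter_subset_right
  have h3 : volume.real C * (ε ^ 2 / 16 * (1 / 2 - t * ε ^ 2)) ≤
      ∫ q in C, (M t q + M t (q + ε)) := by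
    rw [← smul_eq_mul, ← setIntegral_const]
    refine setIntegral_mono_on (integrableOn_const hCfin) (hi1.add hi2) hCm ?_
    intro q hq
    have := hM t q (q + ε) (hBI hq.1).1 (by linarith) (hBI hq.2).2
    simpa using this
  rw [integral_add hi1 hi2] at h3
  have hvC := le_volume_real_inter_preimage_add hB hBI hvol hε.le
  rw [← hC] at hvC
  have hval : ε ^ 2 / 16 * (1 / 2 - t * ε ^ 2) = 1 / 256 * (1 / t) := by
    rw [hε2]; field_simp; norm_num
  rw [hval] at h3
  have htpos : (0 : ℝ) < 1 / t := by positivity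
  nlinarith

theorem TwoPointBound.exists_frequently_log_le_sum {M : ℕ → ℝ → ℝ} (hM : TwoPointBound M)
    (hmeas : ∀ t, Measurable (M t))
    (hM0 : ∀ t, ∀ q ∈ Set.Icc (1 / 4 : ℝ) (3 / 4), 0 ≤ M t q)
    (hint : ∀ t, IntegrableOn (M t) (Set.Icc (1 / 4 : ℝ) (3 / 4))) :
    ∃ Q : Set ℝ, MeasurableSet Q ∧ Q ⊆ Set.Icc (1 / 4 : ℝ) (3 / 4) ∧
      ENNReal.ofReal (1 / 6) ≤ volume Q ∧ ∀ q ∈ Q, ∃ᶠ T : ℕ in atTop,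
        1 / 4096 * Real.log T ≤ ∑ t ∈ Finset.range T, M t q := by
  set I : Set ℝ := Set.Icc (1 / 4 : ℝ) (3 / 4) with hI
  -- `B N` collects the parameters that are good from time N on; Q is the complement of their union
  -- in I.
  let B : ℕ → Set ℝ := fun N =>
    I ∩ ⋂ T : ℕ, ⋂ _ : N ≤ T, {q | ∑ t ∈ Finset.range T, M t q < 1 / 4096 * Real.log T}
  have hBm : ∀ N, MeasurableSet (B N) := fun N =>
    measurableSet_Icc.inter <| MeasurableSet.iInter fun T => MeasurableSet.iInter fun _ =>
      measurableSet_lt (Finset.measurable_sum _ fun t _ => hmeas t) measurable_const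
  have hBI : ∀ N, B N ⊆ I := fun N => Set.inter_subset_left
  have hBmono : Monotone B := fun N N' h => Set.inter_subset_inter_right _ <|
    Set.iInter_mono fun T => Set.iInter_mono' fun hT => ⟨h.trans hT, le_rfl⟩
  have hUm : MeasurableSet (⋃ N, B N) := MeasurableSet.iUnion hBm
  have hUI : (⋃ N, B N) ⊆ I := Set.iUnion_subset hBI
  refine ⟨I \ ⋃ N, B N, measurableSet_Icc.diff hUm, Set.sdiff_subset, ?_, ?_⟩
  · by_contra! hlt
    have hIv : volume I = ENNReal.ofReal (1 / 2) := by
      rw [hI, Real.volume_Icc]; norm_num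
    have hU : ENNReal.ofReal (1 / 3) < volume (⋃ N, B N) := by
      by_contra! hle
      have h := measure_le_inter_add_sdiff volume I (⋃ N, B N)
      rw [Set.inter_eq_right.2 hUI, hIv] at h
      have h' := h.trans_lt (ENNReal.add_lt_add_of_le_of_lt (hle.trans_lt (by simp)).ne hle hlt)
      rw [← ENNReal.ofReal_add (by norm_num) (by norm_num)] at h'
      norm_num at h'
    rw [hBmono.measure_iUnion, lt_iSup_iff] at hU
    obtain ⟨N, hN⟩ := hU
    have hfin : volume (B N) ≠ ⊤ := ((measure_mono (hBI N)).trans_lt (by simp [hIv])).ne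
    have hvol : 1 / 3 ≤ volume.real (B N) := by
      rw [measureReal_def]
      exact (ENNReal.ofReal_le_iff_le_toReal hfin).1 hN.le
    have hvol' : volume.real (B N) ≤ 1 / 2 := by
      rw [measureReal_def]
      exact ENNReal.toReal_le_of_le_ofReal (by norm_num) (hIv ▸ measure_mono (hBI N))
    -- On `B N` the integral is at most log T / 8192 and at least (log T - log 36) / 6144; these
    -- conflict once log T > 4 log 36.
    obtain ⟨T, hTN, hT⟩ : ∃ T : ℕ, N ≤ T ∧ 36 ^ 4 < T :=
      ⟨max N (36 ^ 4 + 1), le_max_left _ _, lt_of_lt_of_le (Nat.lt_succ_self _) (le_max_right _ _)⟩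
    have hT36 : 36 ≤ T := by omega
    have hlog : 4 * Real.log 36 < Real.log T := by
      have : (4 : ℝ) * Real.log 36 = Real.log (36 ^ 4) := by rw [Real.log_pow]; norm_num
      rw [this]
      exact Real.log_lt_log (by norm_num) (by exact_mod_cast hT)
    have hlog36 : 0 < Real.log 36 := Real.log_pos (by norm_num)
    have hBint : ∀ t, IntegrableOn (M t) (B N) := fun t => (hint t).mono_set (hBI N)
    have hup : ∫ q in B N, ∑ t ∈ Finset.range T, M t q ≤
        volume.real (B N) * (1 / 4096 * Real.log T) := by
      rw [← smul_eq_mul, ← setIntegral_const]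
      refine setIntegral_mono_on (integrable_finsetSum _ fun t _ => hBint t)
        (integrableOn_const hfin) (hBm N) fun q hq => ?_
      exact (Set.mem_iInter₂.1 hq.2 T hTN).le
    have hlow : ∑ t ∈ Finset.Ico 36 T, 1 / 6144 * (1 / (t : ℝ)) ≤
        ∫ q in B N, ∑ t ∈ Finset.range T, M t q := by
      rw [integral_finsetSum _ fun t _ => hBint t]
      refine (Finset.sum_le_sum fun t ht => hM.le_setIntegral hM0 hint (hBm N) (hBI N) hvol
        (Finset.mem_Ico.1 ht).1).trans ?_
      refine Finset.sum_le_sum_of_subset_of_nonneg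
        (fun t ht => Finset.mem_range.2 (Finset.mem_Ico.1 ht).2) fun t _ _ => ?_
      exact setIntegral_nonneg (hBm N) fun q hq => hM0 t q (hBI N hq)
    rw [← Finset.mul_sum] at hlow
    have hs := log_le_sum_Ico_inv (m := 36) (n := T) (by norm_num) hT36
    push_cast at hs
    nlinarith
  · rintro q ⟨hqI, hqB⟩
    rw [Filter.frequently_atTop]
    intro N
    by_contra! hcon
    exact hqB (Set.mem_iUnion.2 ⟨N, hqI, Set.mem_iInter₂.2 fun T hT => hcon T hT⟩)

/-! ### The optimal rate and its dependence on q -/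

/-- The optimal constant rate of user 1 in the state `S[t] = 1`. -/
noncomputable def optimalRate (q : ℝ) : ℝ := (-(2 - q) + √(4 - q + 4 * q ^ 2)) / (3 * q)

theorem optimalRate_spec {q : ℝ} (hq : 0 < q) :
    3 * q * optimalRate q ^ 2 + 2 * (2 - q) * optimalRate q - (1 + q) = 0 := by
  have hs := Real.sq_sqrt (show 0 ≤ 4 - q + 4 * q ^ 2 by nlinarith [sq_nonneg (q - 1)])
  have h : 3 * q * optimalRate q = -(2 - q) + √(4 - q + 4 * q ^ 2) := by
    rw [optimalRate]; field_simp
  have h2 : 3 * q * (3 * q * optimalRate q ^ 2 + 2 * (2 - q) * optimalRate q - (1 + q)) = 0 := by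
    linear_combination (3 * q * optimalRate q + 2 * (2 - q) - (2 - q) + √(4 - q + 4 * q ^ 2)) * h
      + hs
  exact (mul_eq_zero.1 h2).resolve_left (by positivity)

theorem optimalRate_mem {q : ℝ} (hq : q ∈ Set.Icc (1 / 4 : ℝ) (3 / 4)) :
    optimalRate q ∈ Set.Icc (1 / 3 : ℝ) (1 / 2) := by
  obtain ⟨h1, h2⟩ := hq
  constructor
  · rw [optimalRate, le_div_iff₀ (by linarith)]
    have : 2 ≤ √(4 - q + 4 * q ^ 2) := Real.le_sqrt_of_sq_le (by nlinarith)
    linarith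
  · rw [optimalRate, div_le_iff₀ (by linarith)]
    have : √(4 - q + 4 * q ^ 2) ≤ 2 + q / 2 := Real.sqrt_le_iff.2 ⟨by linarith, by nlinarith⟩
    linarith

theorem measurable_optimalRate : Measurable optimalRate := by
  unfold optimalRate; fun_prop

theorem le_optimalRate_sub {q q' : ℝ} (hq : 1 / 4 ≤ q) (hqq : q ≤ q') (hq' : q' ≤ 3 / 4) :
    (q' - q) / 4 ≤ optimalRate q' - optimalRate q := by
  obtain ⟨h1, h2⟩ := optimalRate_mem ⟨hq, hqq.trans hq'⟩
  obtain ⟨h1', h2'⟩ := optimalRate_mem ⟨hq.trans hqq, hq'⟩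
  have e := optimalRate_spec (q := q) (by linarith)
  have e' := optimalRate_spec (q := q') (by linarith)
  set r := optimalRate q
  set r' := optimalRate q'
  -- The quadratic is linear in q, so q = (4r - 1)/(1 + 2r - 3r²); this is the difference of two
  -- such fractions, with denominators cleared.
  have key : (q' - q) * ((1 + 2 * r - 3 * r ^ 2) * (1 + 2 * r' - 3 * r' ^ 2)) =
      (r' - r) * (6 - 3 * (r + r') + 12 * r * r') := by
    linear_combination (1 + 2 * r' - 3 * r' ^ 2) * e - (1 + 2 * r - 3 * r ^ 2) * e'
  have g : 5 / 4 ≤ 1 + 2 * r - 3 * r ^ 2 := by nlinarith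
  have g' : 5 / 4 ≤ 1 + 2 * r' - 3 * r' ^ 2 := by nlinarith
  have gg : 25 / 16 ≤ (1 + 2 * r - 3 * r ^ 2) * (1 + 2 * r' - 3 * r' ^ 2) := by nlinarith
  have n1 : 6 - 3 * (r + r') + 12 * r * r' ≤ 6 := by nlinarith
  have n2 : 1 ≤ 6 - 3 * (r + r') + 12 * r * r' := by nlinarith
  have h3 : (q' - q) * (25 / 16) ≤ (r' - r) * (6 - 3 * (r + r') + 12 * r * r') := by
    rw [← key]; exact mul_le_mul_of_nonneg_left gg (by linarith)
  have h4 : 0 ≤ r' - r := by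
    by_contra! h
    nlinarith
  nlinarith

/-! ### Bhattacharyya affinity of state histories -/

/-- The probability of the state history `s` when `P[S[t] = 1] = q`. -/
noncomputable def historyProb (q : ℝ) {t : ℕ} (s : Fin t → Bool) : ℝ :=
  ∏ i, if s i then q else 1 - q

theorem sum_prod_bool (t : ℕ) (f : Bool → ℝ) :
    ∑ s : Fin t → Bool, ∏ i, f (s i) = (f true + f false) ^ t := by
  have := (Finset.prod_univ_sum (fun _ : Fin t => (Finset.univ : Finset Bool))
    (fun _ b => f b)).symm
  rw [Fintype.piFinset_univ] at this
  simpa using this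

theorem sum_historyProb (q : ℝ) (t : ℕ) : ∑ s : Fin t → Bool, historyProb q s = 1 := by
  simp [historyProb, sum_prod_bool t fun b => if b then q else 1 - q]

theorem historyProb_nonneg {q : ℝ} (h0 : 0 ≤ q) (h1 : q ≤ 1) {t : ℕ} (s : Fin t → Bool) :
    0 ≤ historyProb q s :=
  Finset.prod_nonneg fun i _ => by split_ifs <;> linarith

/-- Since √x√y = (x + y - (√x - √y)²)/2 and √x + √y ≥ 1 for x, y ≥ 1/4, one has (√x - √y)² ≤ (x -
y)². Apply this to q, q' and to 1 - q, 1 - q'. -/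
theorem one_sub_sq_le_sqrt_mul_add {q q' : ℝ} (hq : 1 / 4 ≤ q) (hqq : q ≤ q')
    (hq' : q' ≤ 3 / 4) :
    1 - (q' - q) ^ 2 ≤ √q * √q' + √(1 - q) * √(1 - q') := by
  have aux : ∀ x y : ℝ, 1 / 4 ≤ x → 1 / 4 ≤ y → (x + y - (x - y) ^ 2) / 2 ≤ √x * √y := by
    intro x y hx hy
    have hx' : 1 / 2 ≤ √x := Real.le_sqrt_of_sq_le (by linarith)
    have hy' : 1 / 2 ≤ √y := Real.le_sqrt_of_sq_le (by linarith)
    have ex := Real.sq_sqrt (show 0 ≤ x by linarith)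
    have ey := Real.sq_sqrt (show 0 ≤ y by linarith)
    set a := √x
    set b := √y
    have : (a - b) ^ 2 ≤ (x - y) ^ 2 := by
      rw [← ex, ← ey, show a ^ 2 - b ^ 2 = (a - b) * (a + b) by ring, mul_pow]
      nlinarith [sq_nonneg (a - b), mul_nonneg (sq_nonneg (a - b))
        (show 0 ≤ (a + b) ^ 2 - 1 by nlinarith)]
    nlinarith
  have h1 := aux q q' hq (by linarith)
  have h2 := aux (1 - q) (1 - q') (by linarith) (by linarith)
  nlinarith

/-- The affinity of product laws is the t-th power of the one-slot affinity, to which Bernoulli's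
inequality applies. -/
theorem le_sum_sqrt_historyProb {q q' : ℝ} (hq : 1 / 4 ≤ q) (hqq : q ≤ q') (hq' : q' ≤ 3 / 4)
    (t : ℕ) :
    1 - t * (q' - q) ^ 2 ≤
      ∑ s : Fin t → Bool, √(historyProb q s) * √(historyProb q' s) := by
  have hs : ∀ s : Fin t → Bool, √(historyProb q s) * √(historyProb q' s) =
      ∏ i, if s i then √q * √q' else √(1 - q) * √(1 - q') := by
    intro s
    have : ∀ p : ℝ, 1 / 4 ≤ p → p ≤ 3 / 4 →
        √(historyProb p s) = ∏ i, if s i then √p else √(1 - p) := by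
      intro p h1 h2
      rw [historyProb, Real.sqrt_eq_iff_mul_self_eq, ← Finset.prod_mul_distrib]
      · refine Finset.prod_congr rfl fun i _ => ?_
        split_ifs <;> rw [Real.mul_self_sqrt (by linarith)]
      · exact Finset.prod_nonneg fun i _ => by split_ifs <;> linarith
      · exact Finset.prod_nonneg fun i _ => by split_ifs <;> positivity
    rw [this q hq (by linarith), this q' (by linarith) hq', ← Finset.prod_mul_distrib]
    refine Finset.prod_congr rfl fun i _ => ?_
    split_ifs <;> rfl
  rw [Finset.sum_congr rfl fun s _ => hs s,
    sum_prod_bool t fun b => if b then √q * √q' else √(1 - q) * √(1 - q')]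
  have h := one_add_mul_le_pow (a := -(q' - q) ^ 2) (by nlinarith) t
  have hb := one_sub_sq_le_sqrt_mul_add hq hqq hq'
  calc 1 - t * (q' - q) ^ 2 = 1 + t * -(q' - q) ^ 2 := by ring
    _ ≤ (1 + -(q' - q) ^ 2) ^ t := h
    _ ≤ _ := pow_le_pow_left₀ (by nlinarith) (by simp; linarith) t

/-! ### Risk of an algorithm and its two-point bound -/

section

variable {U : Type*} [MeasurableSpace U]

/-- The rate of user 1 chosen in slot `t` if `S[t] = 1`, as a function of the seed and the past
states. -/
def Algorithm.onRate (A : Algorithm U) (t : ℕ) (u : U) (s : Fin t → Bool) : ℝ :=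
  (A.decide t u (Fin.snoc s true)).1

theorem Algorithm.onRate_spec (A : Algorithm U) (t : ℕ) (u : U) (s : Fin t → Bool) :
    0 ≤ A.onRate t u s ∧ A.onRate t u s ≤ 1 ∧
      A.decide t u (Fin.snoc s true) = (A.onRate t u s, 1 - A.onRate t u s ^ 2) := by
  have h := A.decide_mem t u (Fin.snoc s true)
  rw [Fin.snoc_last] at h
  obtain ⟨r, h0, h1, hr⟩ := h
  simp only [onRate, hr]
  exact ⟨h0, h1, trivial⟩

theorem Algorithm.measurable_onRate (A : Algorithm U) (t : ℕ) (s : Fin t → Bool) :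
    Measurable fun u => A.onRate t u s :=
  ((A.measurable_decide t).comp (measurable_id.prodMk measurable_const)).fst

variable (ν : Measure U)

/-- The mean of a function of the past states and the seed, when `P[S[t] = 1] = q`. -/
noncomputable def historyMean (q : ℝ) {t : ℕ} (f : U → (Fin t → Bool) → ℝ) : ℝ :=
  ∑ s : Fin t → Bool, historyProb q s * ∫ u, f u s ∂ν

/-- The mean squared distance of the rate chosen in slot `t` from the optimal rate. -/
noncomputable def Algorithm.risk (A : Algorithm U) (t : ℕ) (q : ℝ) : ℝ :=
  historyMean ν q fun u s => (A.onRate t u s - optimalRate q) ^ 2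

theorem Algorithm.risk_nonneg (A : Algorithm U) (t : ℕ) {q : ℝ}
    (hq : q ∈ Set.Icc (1 / 4 : ℝ) (3 / 4)) : 0 ≤ A.risk ν t q :=
  Finset.sum_nonneg fun s _ => mul_nonneg
    (historyProb_nonneg (by linarith [hq.1]) (by linarith [hq.2]) s)
    (integral_nonneg fun u => sq_nonneg _)

variable [IsProbabilityMeasure ν]

theorem Algorithm.integrable_onRate (A : Algorithm U) (t : ℕ) (s : Fin t → Bool) :
    Integrable (fun u => A.onRate t u s) ν :=
  Integrable.of_mem_Icc 0 1 (A.measurable_onRate t s).aemeasurable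
    (ae_of_all _ fun u => ⟨(A.onRate_spec t u s).1, (A.onRate_spec t u s).2.1⟩)

theorem Algorithm.integrable_onRate_sq (A : Algorithm U) (t : ℕ) (s : Fin t → Bool) :
    Integrable (fun u => A.onRate t u s ^ 2) ν :=
  Integrable.of_mem_Icc 0 1 ((A.measurable_onRate t s).pow_const 2).aemeasurable
    (ae_of_all _ fun u => ⟨sq_nonneg _,
      pow_le_one₀ (A.onRate_spec t u s).1 (A.onRate_spec t u s).2.1⟩)

theorem Algorithm.integral_onRate_sub_sq (A : Algorithm U) (t : ℕ) (s : Fin t → Bool) (a : ℝ) :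
    ∫ u, (A.onRate t u s - a) ^ 2 ∂ν =
      ∫ u, A.onRate t u s ^ 2 ∂ν - 2 * a * ∫ u, A.onRate t u s ∂ν + a ^ 2 := by
  have h1 := A.integrable_onRate ν t s
  have h2 := A.integrable_onRate_sq ν t s
  have : ∀ u, (A.onRate t u s - a) ^ 2 =
      A.onRate t u s ^ 2 - 2 * a * A.onRate t u s + a ^ 2 := fun u => by ring
  simp_rw [this]
  rw [integral_add (f := fun u => A.onRate t u s ^ 2 - 2 * a * A.onRate t u s)
    (h2.sub (h1.const_mul _)) (integrable_const _), integral_sub h2 (h1.const_mul _),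
    integral_const_mul]
  simp

theorem Algorithm.integrable_onRate_sub_sq (A : Algorithm U) (t : ℕ) (s : Fin t → Bool) (a : ℝ) :
    Integrable (fun u => (A.onRate t u s - a) ^ 2) ν := by
  have : (fun u => (A.onRate t u s - a) ^ 2) = fun u =>
      A.onRate t u s ^ 2 - 2 * a * A.onRate t u s + a ^ 2 := by ext u; ring
  rw [this]
  exact ((A.integrable_onRate_sq ν t s).sub ((A.integrable_onRate ν t s).const_mul _)).add
    (integrable_const _)

theorem Algorithm.risk_eq (A : Algorithm U) (t : ℕ) (q : ℝ) :
    A.risk ν t q = historyMean ν q (fun u s => A.onRate t u s ^ 2) -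
      2 * optimalRate q * historyMean ν q (A.onRate t) + optimalRate q ^ 2 := by
  have h1 := sum_historyProb q t
  simp only [risk, historyMean, A.integral_onRate_sub_sq ν, Finset.mul_sum]
  have h2 : optimalRate q ^ 2 = ∑ s : Fin t → Bool, historyProb q s * optimalRate q ^ 2 := by
    rw [← Finset.sum_mul, h1, one_mul]
  conv_rhs => rw [h2]
  rw [← Finset.sum_sub_distrib, ← Finset.sum_add_distrib]
  exact Finset.sum_congr rfl fun s _ => by ring

theorem Algorithm.measurable_risk (A : Algorithm U) (t : ℕ) : Measurable (A.risk ν t) := by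
  have hm := measurable_optimalRate
  have hp : ∀ s : Fin t → Bool, Measurable fun q => historyProb q s := fun s => by
    unfold historyProb
    refine Finset.measurable_prod _ fun i _ => ?_
    split_ifs <;> fun_prop
  simp only [funext (A.risk_eq ν t), historyMean]
  fun_prop

theorem Algorithm.risk_le_one (A : Algorithm U) (t : ℕ) {q : ℝ}
    (hq : q ∈ Set.Icc (1 / 4 : ℝ) (3 / 4)) : A.risk ν t q ≤ 1 := by
  rw [← sum_historyProb q t]
  refine Finset.sum_le_sum fun s _ => mul_le_of_le_one_right
    (historyProb_nonneg (by linarith [hq.1]) (by linarith [hq.2]) s) ?_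
  have h := integral_mono (A.integrable_onRate_sub_sq ν t s (optimalRate q)) (integrable_const 1)
    fun u => show (A.onRate t u s - optimalRate q) ^ 2 ≤ 1 by
      obtain ⟨h0, h1, -⟩ := A.onRate_spec t u s
      obtain ⟨h2, h3⟩ := optimalRate_mem hq
      nlinarith
  simpa using h

theorem Algorithm.integrableOn_risk (A : Algorithm U) (t : ℕ) :
    IntegrableOn (A.risk ν t) (Set.Icc (1 / 4 : ℝ) (3 / 4)) :=
  Integrable.of_mem_Icc 0 1 (A.measurable_risk ν t).aemeasurable
    ((ae_restrict_iff' measurableSet_Icc).2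
      (ae_of_all _ fun _ hq => ⟨A.risk_nonneg ν t hq, A.risk_le_one ν t hq⟩))

/-- A pointwise inequality in the seed and the history, integrated and summed over histories, gives
D²(1 - t(q' - q)²) - D²/2, where D ≥ (q' - q)/4. -/
theorem Algorithm.twoPointBound_risk (A : Algorithm U) : TwoPointBound (A.risk ν) := by
  intro t q q' hq hqq hq'
  set D := optimalRate q' - optimalRate q with hDdef
  have hD : (q' - q) / 4 ≤ D := le_optimalRate_sub hq hqq.le hq'
  have hterm : ∀ s : Fin t → Bool,
      D ^ 2 * (√(historyProb q s) * √(historyProb q' s)) -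
        D ^ 2 / 4 * (historyProb q s + historyProb q' s) ≤
      historyProb q s * ∫ u, (A.onRate t u s - optimalRate q) ^ 2 ∂ν +
        historyProb q' s * ∫ u, (A.onRate t u s - optimalRate q') ^ 2 ∂ν := by
    intro s
    have e := Real.sq_sqrt (historyProb_nonneg (by linarith) (by linarith) s : 0 ≤ historyProb q s)
    have e' := Real.sq_sqrt
      (historyProb_nonneg (by linarith) (by linarith) s : 0 ≤ historyProb q' s)
    have i1 := (A.integrable_onRate_sub_sq ν t s (optimalRate q)).const_mul (historyProb q s)
    have i2 := (A.integrable_onRate_sub_sq ν t s (optimalRate q')).const_mul (historyProb q' s)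
    rw [← integral_const_mul, ← integral_const_mul, ← integral_add i1 i2]
    have h := integral_mono (integrable_const (D ^ 2 * (√(historyProb q s) * √(historyProb q' s)) -
        D ^ 2 / 4 * (historyProb q s + historyProb q' s))) (i1.add i2) fun u => by
      have hx : A.onRate t u s - optimalRate q' = (A.onRate t u s - optimalRate q) - D := by
        rw [hDdef]; ring
      simp only [Pi.add_apply, hx]
      generalize A.onRate t u s - optimalRate q = x
      generalize √(historyProb q s) = a at e ⊢
      generalize √(historyProb q' s) = b at e' ⊢
      rw [← e, ← e']
      -- When the two squares are expanded and added, the terms ±Dabx cancel and D²ab remains.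
      nlinarith [sq_nonneg (a * x - D / 2 * b), sq_nonneg (b * (x - D) + D / 2 * a)]
    simpa using h
  have hsum := Finset.sum_le_sum fun s (_ : s ∈ Finset.univ) => hterm s
  rw [Finset.sum_sub_distrib, ← Finset.mul_sum, ← Finset.mul_sum, Finset.sum_add_distrib,
    Finset.sum_add_distrib, sum_historyProb, sum_historyProb] at hsum
  have hB := le_sum_sqrt_historyProb hq hqq.le hq' t
  have h1 : (q' - q) ^ 2 / 16 ≤ D ^ 2 := by nlinarith
  rcases le_total (1 / 2 - t * (q' - q) ^ 2) 0 with h | h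
  · have h0 := A.risk_nonneg ν t ⟨hq, hqq.le.trans hq'⟩
    have h0' := A.risk_nonneg ν t ⟨hq.trans hqq.le, hq'⟩
    nlinarith [mul_nonneg (sq_nonneg (q' - q)) (neg_nonneg.2 h)]
  · refine le_trans ?_ hsum
    have h2 := mul_le_mul_of_nonneg_right h1 h
    have h3 := mul_le_mul_of_nonneg_left hB (sq_nonneg D)
    linarith

end

/-! ### Boundedness of utilities and a lower bound for φ* -/

theorem decisionSet_mem_Icc {b : Bool} {x : ℝ × ℝ} (hx : x ∈ decisionSet b) :
    x.1 ∈ Set.Icc (0 : ℝ) 1 ∧ x.2 ∈ Set.Icc (0 : ℝ) 1 := by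
  cases b with
  | false =>
    rw [show x = (1, 0) from hx]
    simp
  | true =>
    obtain ⟨r, h0, h1, rfl⟩ := hx
    exact ⟨⟨h0, h1⟩, by nlinarith, by nlinarith⟩

section

variable {Ω : Type*} [MeasurableSpace Ω] (P : Measure Ω) [IsProbabilityMeasure P]

theorem integrable_of_mem_decisionSet {S : Ω → Bool} {X : Ω → ℝ × ℝ} (hX : Measurable X)
    (hmem : ∀ ω, X ω ∈ decisionSet (S ω)) :
    Integrable (fun ω => (X ω).1) P ∧ Integrable (fun ω => (X ω).2) P :=
  ⟨Integrable.of_mem_Icc 0 1 hX.fst.aemeasurable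
      (ae_of_all _ fun ω => (decisionSet_mem_Icc (hmem ω)).1),
    Integrable.of_mem_Icc 0 1 hX.snd.aemeasurable
      (ae_of_all _ fun ω => (decisionSet_mem_Icc (hmem ω)).2)⟩

theorem expectedUtility_eq {S : ℕ → Ω → Bool} {X : ℕ → Ω → ℝ × ℝ} (hX : ∀ t, Measurable (X t))
    (hmem : ∀ t ω, X t ω ∈ decisionSet (S t ω)) (T : ℕ) :
    expectedUtility P X T = utility (1 / T * ∑ t ∈ Finset.range T, ∫ ω, (X t ω).1 ∂P)
      (1 / T * ∑ t ∈ Finset.range T, ∫ ω, (X t ω).2 ∂P) := by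
  have h := fun t => integrable_of_mem_decisionSet P (hX t) (hmem t)
  simp only [expectedUtility, timeAverage, Prod.smul_fst, Prod.smul_snd, Prod.fst_sum,
    Prod.snd_sum, smul_eq_mul]
  rw [integral_const_mul, integral_const_mul, integral_finsetSum _ fun t _ => (h t).1,
    integral_finsetSum _ fun t _ => (h t).2]

theorem average_mem_Icc {f : ℕ → ℝ} (hf : ∀ t, f t ∈ Set.Icc (0 : ℝ) 1) (T : ℕ) :
    1 / (T : ℝ) * ∑ t ∈ Finset.range T, f t ∈ Set.Icc (0 : ℝ) 1 := by
  refine ⟨mul_nonneg (by positivity) (Finset.sum_nonneg fun t _ => (hf t).1), ?_⟩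
  have : ∑ t ∈ Finset.range T, f t ≤ T := by
    simpa using Finset.sum_le_sum fun t (_ : t ∈ Finset.range T) => (hf t).2
  rw [one_div, inv_mul_eq_div]
  exact div_le_one_of_le₀ this (by positivity)

theorem utility_mem_Icc {x y : ℝ} (hx : x ∈ Set.Icc (0 : ℝ) 1) (hy : y ∈ Set.Icc (0 : ℝ) 1) :
    utility x y ∈ Set.Icc 0 (2 * Real.log 2) := by
  have aux : ∀ z ∈ Set.Icc (0 : ℝ) 1, 0 ≤ Real.log (1 + z) ∧ Real.log (1 + z) ≤ Real.log 2 :=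
    fun z hz => ⟨Real.log_nonneg (by linarith [hz.1]),
      Real.log_le_log (by linarith [hz.1]) (by linarith [hz.2])⟩
  have h1 := aux x hx
  have h2 := aux y hy
  exact ⟨add_nonneg h1.1 h2.1, by rw [utility]; linarith⟩

theorem expectedUtility_mem_Icc {S : ℕ → Ω → Bool} {X : ℕ → Ω → ℝ × ℝ}
    (hX : ∀ t, Measurable (X t)) (hmem : ∀ t ω, X t ω ∈ decisionSet (S t ω)) (T : ℕ) :
    expectedUtility P X T ∈ Set.Icc 0 (2 * Real.log 2) := by
  have hi := fun t => integrable_of_mem_decisionSet P (hX t) (hmem t)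
  have hb := fun t ω => decisionSet_mem_Icc (hmem t ω)
  rw [expectedUtility_eq P hX hmem]
  refine utility_mem_Icc (average_mem_Icc (fun t => ⟨integral_nonneg fun ω => (hb t ω).1.1, ?_⟩) T)
    (average_mem_Icc (fun t => ⟨integral_nonneg fun ω => (hb t ω).2.1, ?_⟩) T)
  · simpa using integral_mono (hi t).1 (integrable_const 1) fun ω => (hb t ω).1.2
  · simpa using integral_mono (hi t).2 (integrable_const 1) fun ω => (hb t ω).2.2

end

/-- Needed for attainable values to bound `optimalUtility` from below, as `sSup` of an unbounded set
of reals is the default 0. -/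
theorem bddAbove_attainableUtilities (q : unitInterval) : BddAbove (attainableUtilities q) := by
  refine ⟨2 * Real.log 2, ?_⟩
  rintro v ⟨Ω, _, P, _, S, X, -, hX, hmem, rfl⟩
  have h := expectedUtility_mem_Icc P hX hmem
  exact liminf_le_of_frequently_le (Frequently.of_forall fun T => (h T).2)
    (isBoundedUnder_of ⟨0, fun T => (h T).1⟩)

theorem utility_const_le_optimalUtility (q : unitInterval) {r : ℝ} (h0 : 0 ≤ r) (h1 : r ≤ 1) :
    utility (1 - q + q * r) (q * (1 - r ^ 2)) ≤ optimalUtility q := by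
  refine le_csSup (bddAbove_attainableUtilities q) ?_
  let P : Measure (ℕ → Bool) := Measure.infinitePi fun _ : ℕ => bernoulliMeasure true false q
  let g : Bool → ℝ × ℝ := fun b => if b then (r, 1 - r ^ 2) else (1, 0)
  have hmem : ∀ (t : ℕ) (ω : ℕ → Bool), g (ω t) ∈ decisionSet (ω t) := by
    intro t ω
    cases h : ω t
    · simp [g, decisionSet]
    · exact ⟨r, h0, h1, by simp [g]⟩
  have hg : Measurable g := measurable_of_finite g
  have hX : ∀ t : ℕ, Measurable fun ω : ℕ → Bool => g (ω t) := fun t =>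
    hg.comp (measurable_pi_apply t)
  have hint : ∀ (t : ℕ) (φ : ℝ × ℝ → ℝ), ∫ ω, φ (g (ω t)) ∂P =
      q * φ (r, 1 - r ^ 2) + (1 - q) * φ (1, 0) := by
    intro t φ
    have h := Measure.infinitePi_map_eval (fun _ : ℕ => bernoulliMeasure true false q) t
    have h2 := integral_map (μ := P) (φ := fun ω => ω t) (measurable_pi_apply t).aemeasurable
      (f := fun b => φ (g b)) (measurable_of_finite _).aestronglyMeasurable
    rw [← h2]
    change ∫ b, φ (g b) ∂(P.map fun ω => ω t) = _
    rw [show (P.map fun ω => ω t) = bernoulliMeasure true false q from h]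
    simp [integral_bernoulliMeasure, g]
  refine ⟨ℕ → Bool, inferInstance, P, inferInstance, fun t ω => ω t, fun t ω => g (ω t),
    ⟨fun t => measurable_pi_apply t, ?_, fun t => ?_⟩, hX, hmem, ?_⟩
  · exact iIndepFun_infinitePi (P := fun _ : ℕ => bernoulliMeasure true false q)
      (X := fun _ b => b) fun _ => measurable_id
  · exact Measure.infinitePi_map_eval (fun _ : ℕ => bernoulliMeasure true false q) t
  · refine (Tendsto.liminf_eq (tendsto_const_nhds.congr' ?_)).symm
    filter_upwards [eventually_ge_atTop 1] with T hT
    have hT' : (T : ℝ) ≠ 0 := by positivity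
    rw [expectedUtility_eq P hX hmem]
    simp only [hint _ Prod.fst, hint _ Prod.snd, Finset.sum_const, Finset.card_range, nsmul_eq_mul]
    congr 1 <;> field_simp <;> ring

/-! ### Expected rates as means over finite histories -/

theorem infinitePi_real_history (q : unitInterval) {n : ℕ} (s : Fin n → Bool) :
    (Measure.infinitePi fun _ : ℕ => bernoulliMeasure true false q).real
      {σ | (fun i : Fin n => σ i) = s} = historyProb q s := by
  have hset : {σ : ℕ → Bool | (fun i : Fin n => σ i) = s} =
      Set.pi (Finset.range n) fun i => if h : i < n then {s ⟨i, h⟩} else Set.univ := by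
    ext σ
    simp only [Set.mem_ofPred_eq, funext_iff, Set.mem_pi, Finset.coe_range, Set.mem_Iio]
    constructor
    · intro h i hi
      simpa [hi] using h ⟨i, hi⟩
    · intro h i
      simpa using h i i.2
  rw [hset, measureReal_def, Measure.infinitePi_pi _ fun _ _ => .of_discrete,
    ENNReal.toReal_prod, Finset.prod_range, historyProb]
  refine Finset.prod_congr rfl fun i _ => ?_
  rw [dif_pos i.2, ← measureReal_def]
  cases s i <;> simp

section

variable {U : Type*} [MeasurableSpace U]

theorem Algorithm.measurable_rates (A : Algorithm U) (t : ℕ) : Measurable (A.rates t) :=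
  (A.measurable_decide t).comp (measurable_fst.prodMk
    (measurable_pi_lambda _ fun _ => (measurable_pi_apply _).comp measurable_snd))

theorem Algorithm.rates_mem (A : Algorithm U) (t : ℕ) (ω : U × (ℕ → Bool)) :
    A.rates t ω ∈ decisionSet (ω.2 t) := by
  simpa [rates] using A.decide_mem t ω.1 fun i => ω.2 i

variable (ν : Measure U)

theorem historyMean_succ (q : ℝ) {n : ℕ} (f : U → (Fin (n + 1) → Bool) → ℝ) :
    historyMean ν q f = q * historyMean ν q (fun u s => f u (Fin.snoc s true)) +
      (1 - q) * historyMean ν q (fun u s => f u (Fin.snoc s false)) := by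
  rw [historyMean, ← (Fin.snocEquiv fun _ : Fin (n + 1) => Bool).sum_comp, Fintype.sum_prod_type,
    Fintype.sum_bool]
  simp only [historyMean, Finset.mul_sum, historyProb, Fin.prod_univ_castSucc, Fin.snocEquiv, Equiv.coe_fn_mk,
    Fin.snoc_castSucc, Fin.snoc_last]
  congr 1 <;> refine Finset.sum_congr rfl fun s _ => ?_ <;> simp <;> ring

variable [IsProbabilityMeasure ν]

instance (q : unitInterval) : IsProbabilityMeasure (systemLaw ν q) := by
  unfold systemLaw; infer_instance

theorem historyMean_mem_Icc (q : unitInterval) {n : ℕ} {f : U → (Fin n → Bool) → ℝ}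
    (hf : ∀ s, Integrable (fun u => f u s) ν) (hmem : ∀ u s, f u s ∈ Set.Icc (0 : ℝ) 1) :
    historyMean ν q f ∈ Set.Icc (0 : ℝ) 1 := by
  have hp := fun s : Fin n → Bool => historyProb_nonneg q.2.1 q.2.2 s
  refine ⟨Finset.sum_nonneg fun s _ => mul_nonneg (hp s) (integral_nonneg fun u => (hmem u s).1),
    ?_⟩
  rw [← sum_historyProb q n]
  refine Finset.sum_le_sum fun s _ => mul_le_of_le_one_right (hp s) ?_
  simpa using integral_mono (hf s) (integrable_const 1) fun u => (hmem u s).2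

theorem integral_systemLaw_history (q : unitInterval) {n : ℕ} {f : U → (Fin n → Bool) → ℝ}
    (hf : ∀ s, Integrable (fun u => f u s) ν) :
    ∫ ω, f ω.1 (fun i => ω.2 i) ∂(systemLaw ν q) = historyMean ν q f := by
  classical
  let E : (Fin n → Bool) → Set (ℕ → Bool) := fun s => {σ | (fun i : Fin n => σ i) = s}
  have hrestr : Measurable fun (σ : ℕ → Bool) (i : Fin n) => σ i :=
    measurable_pi_lambda _ fun i => measurable_pi_apply (i : ℕ)
  have hE : ∀ s, MeasurableSet (E s) := fun s => hrestr (measurableSet_singleton s)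
  have hsum : ∀ ω : U × (ℕ → Bool), f ω.1 (fun i => ω.2 i) =
      ∑ s, f ω.1 s * (E s).indicator (fun _ => (1 : ℝ)) ω.2 := by
    intro ω
    rw [Finset.sum_eq_single (fun i : Fin n => ω.2 i)]
    · simp [E]
    · intro s _ hs
      simp [E, Set.indicator_of_notMem, Ne.symm hs]
    · simp
  simp_rw [hsum]
  rw [systemLaw, integral_finsetSum _ fun s _ =>
    (hf s).mul_prod ((integrable_const (1 : ℝ)).indicator (hE s)), historyMean]
  refine Finset.sum_congr rfl fun s _ => ?_
  rw [integral_prod_mul (fun u => f u s), integral_indicator_const _ (hE s),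
    infinitePi_real_history]
  simp [mul_comm]

theorem Algorithm.integral_rates (A : Algorithm U) (q : unitInterval) (t : ℕ) :
    ∫ ω, (A.rates t ω).1 ∂(systemLaw ν q) = 1 - q + q * historyMean ν q (A.onRate t) ∧
    ∫ ω, (A.rates t ω).2 ∂(systemLaw ν q) =
      q * (1 - historyMean ν q fun u s => A.onRate t u s ^ 2) := by
  have hm : ∀ s, Measurable fun u => A.decide t u s := fun s =>
    (A.measurable_decide t).comp (measurable_id.prodMk measurable_const)
  have hi := fun s => integrable_of_mem_decisionSet ν (hm s) fun u => A.decide_mem t u s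
  have hoff : ∀ u (s : Fin t → Bool), A.decide t u (Fin.snoc s false) = (1, 0) := fun u s => by
    have h := A.decide_mem t u (Fin.snoc s false)
    rw [Fin.snoc_last] at h
    exact h
  have hon := fun u (s : Fin t → Bool) => (A.onRate_spec t u s).2.2
  have hone : historyMean ν (q : ℝ) (fun _ (_ : Fin t → Bool) => (1 : ℝ)) = 1 := by
    simp [historyMean, sum_historyProb]
  constructor
  · refine (integral_systemLaw_history ν q (f := fun u s => (A.decide t u s).1)
      fun s => (hi s).1).trans ?_
    rw [historyMean_succ]
    simp only [hoff, hon, hone]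
    change _ * historyMean ν q (A.onRate t) + _ = _
    ring
  · refine (integral_systemLaw_history ν q (f := fun u s => (A.decide t u s).2)
      fun s => (hi s).2).trans ?_
    rw [historyMean_succ]
    have h1 : historyMean ν (q : ℝ) (fun u (s : Fin t → Bool) => 1 - A.onRate t u s ^ 2) =
        1 - historyMean ν q fun u s => A.onRate t u s ^ 2 := by
      conv_rhs => rw [← hone]
      simp only [historyMean, ← Finset.sum_sub_distrib, ← mul_sub]
      exact Finset.sum_congr rfl fun s _ => by
        rw [integral_sub (integrable_const _) (A.integrable_onRate_sq ν t s)]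
    have h0 : historyMean ν (q : ℝ) (fun _ (_ : Fin t → Bool) => (0 : ℝ)) = 0 := by
      simp [historyMean]
    simp only [hoff, hon, h1, h0]
    ring

/-! ### The utility gap dominates the accumulated risk -/

/-- Here a and v play the roles of the averaged first and second moments of the rate in state 1, so
v - 2ra + r² is its mean squared distance from r. By stationarity, the tangent plane of φ at the
constant rate r falls by exactly p(v - 2ra + r²)/(1 + p(1 - r²)). -/
theorem utility_gap {p r a v : ℝ} (hp : 1 / 4 ≤ p) (hp' : p ≤ 3 / 4) (hr : 0 ≤ r) (hr' : r ≤ 1)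
    (hspec : 3 * p * r ^ 2 + 2 * (2 - p) * r - (1 + p) = 0) (ha : 0 ≤ p * a)
    (hv : 0 ≤ p * (1 - v)) (hgap : 0 ≤ v - 2 * r * a + r ^ 2) :
    1 / 5 * (v - 2 * r * a + r ^ 2) ≤
      utility (1 - p + p * r) (p * (1 - r ^ 2)) - utility (1 - p + p * a) (p * (1 - v)) := by
  have aux : ∀ X x : ℝ, 0 < X → 0 < x → Real.log X - Real.log x ≤ (X - x) / x := by
    intro X x hX hx
    rw [← Real.log_div hX.ne' hx.ne', sub_div, div_self hx.ne']
    exact Real.log_le_sub_one_of_pos (by positivity)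
  have hx : 0 < 1 + (1 - p + p * r) := by nlinarith
  have hy : 0 < 1 + p * (1 - r ^ 2) := by nlinarith
  have h1 := aux (1 + (1 - p + p * a)) _ (by linarith) hx
  have h2 := aux (1 + p * (1 - v)) _ (by linarith) hy
  -- This is the first-order condition p/x = 2pr/y with x = 1 + x₁ and y = 1 + x₂ at the constant
  -- rate r.
  have hxy : 1 + p * (1 - r ^ 2) = 2 * r * (1 + (1 - p + p * r)) := by linear_combination -hspec
  have e1 : (1 + (1 - p + p * a) - (1 + (1 - p + p * r))) / (1 + (1 - p + p * r)) =
      2 * r * (p * (a - r)) / (1 + p * (1 - r ^ 2)) := by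
    rw [div_eq_div_iff hx.ne' hy.ne', hxy]; ring
  have e2 : 1 / 5 * (v - 2 * r * a + r ^ 2) ≤
      -- The factor 1/5 comes from 1 + p(1 - r²) ≤ 1 + p ≤ 5p.
      p * (v - 2 * r * a + r ^ 2) / (1 + p * (1 - r ^ 2)) := by
    rw [le_div_iff₀ hy]
    have : 1 + p * (1 - r ^ 2) ≤ 5 * p := by nlinarith
    nlinarith
  have e3 : p * (v - 2 * r * a + r ^ 2) / (1 + p * (1 - r ^ 2)) =
      -(2 * r * (p * (a - r)) / (1 + p * (1 - r ^ 2))) -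
        (1 + p * (1 - v) - (1 + p * (1 - r ^ 2))) / (1 + p * (1 - r ^ 2)) := by
    rw [← neg_div, ← sub_div]; congr 1; ring
  rw [e1] at h1
  simp only [utility]
  linarith

theorem Algorithm.sum_risk_le (A : Algorithm U) {q : unitInterval}
    (hq : (q : ℝ) ∈ Set.Icc (1 / 4 : ℝ) (3 / 4)) {T : ℕ} (hT : 1 ≤ T) :
    1 / 5 * ∑ t ∈ Finset.range T, A.risk ν t q ≤
      T * optimalUtility q - T * A.performance ν q T := by
  have hT0 : (0 : ℝ) < T := by exact_mod_cast hT
  obtain ⟨hq1, hq2⟩ := hq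
  obtain ⟨hr1, hr2⟩ := optimalRate_mem ⟨hq1, hq2⟩
  have hspec := optimalRate_spec (q := q) (by linarith)
  have hW : 1 / (T : ℝ) * ∑ t ∈ Finset.range T, A.risk ν t q =
      1 / T * (∑ t ∈ Finset.range T, historyMean ν q fun u s => A.onRate t u s ^ 2) -
      2 * optimalRate q * (1 / T * ∑ t ∈ Finset.range T, historyMean ν q (A.onRate t)) +
      optimalRate q ^ 2 := by
    simp only [A.risk_eq ν, Finset.sum_add_distrib, Finset.sum_sub_distrib, ← Finset.mul_sum,
      Finset.sum_const, Finset.card_range, nsmul_eq_mul]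
    field_simp
  have hW0 : 0 ≤ 1 / (T : ℝ) * ∑ t ∈ Finset.range T, A.risk ν t q :=
    mul_nonneg (by positivity) (Finset.sum_nonneg fun t _ => A.risk_nonneg ν t ⟨hq1, hq2⟩)
  have hperf : A.performance ν q T = utility
      (1 - q + q * (1 / T * ∑ t ∈ Finset.range T, historyMean ν q (A.onRate t)))
      (q * (1 - 1 / T * ∑ t ∈ Finset.range T, historyMean ν q fun u s => A.onRate t u s ^ 2)) := by
    rw [Algorithm.performance, expectedUtility_eq (systemLaw ν q) A.measurable_rates A.rates_mem]
    simp only [A.integral_rates ν q, Finset.sum_add_distrib, Finset.sum_sub_distrib,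
      ← Finset.mul_sum, Finset.sum_const, Finset.card_range, nsmul_eq_mul]
    congr 1 <;> field_simp
  have hpos : 0 ≤ (q : ℝ) * (1 / T * ∑ t ∈ Finset.range T, historyMean ν q (A.onRate t)) ∧
      0 ≤ (q : ℝ) * (1 - 1 / T * ∑ t ∈ Finset.range T,
        historyMean ν q fun u s => A.onRate t u s ^ 2) := by
    have h1 := average_mem_Icc (fun t => historyMean_mem_Icc ν q (A.integrable_onRate ν t)
      fun u s => ⟨(A.onRate_spec t u s).1, (A.onRate_spec t u s).2.1⟩) T
    have h2 := average_mem_Icc (fun t => historyMean_mem_Icc ν q (A.integrable_onRate_sq ν t)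
      fun u s => ⟨sq_nonneg _, pow_le_one₀ (A.onRate_spec t u s).1 (A.onRate_spec t u s).2.1⟩) T
    exact ⟨mul_nonneg q.2.1 h1.1, mul_nonneg q.2.1 (sub_nonneg.2 h2.2)⟩
  have hopt := utility_const_le_optimalUtility q (r := optimalRate q) (by linarith) (by linarith)
  have hfin : 1 / 5 * (1 / (T : ℝ) * ∑ t ∈ Finset.range T, A.risk ν t q) ≤
      optimalUtility q - A.performance ν q T := by
    refine le_trans ?_ (sub_le_sub_right hopt _)
    rw [hperf]
    rw [hW] at hW0 ⊢
    exact utility_gap (by linarith) hq2 (by linarith) (by linarith) hspec hpos.1 hpos.2 hW0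
  have := mul_le_mul_of_nonneg_left hfin hT0.le
  calc _ = T * (1 / 5 * (1 / (T : ℝ) * ∑ t ∈ Finset.range T, A.risk ν t q)) := by field_simp
    _ ≤ _ := by linarith

end

end OpportunisticScheduling

theorem theorem3 :
    (∃ c : ℝ, 0 < c ∧
      ∀ (U : Type*) [MeasurableSpace U] (ν : Measure U) [IsProbabilityMeasure ν]
        (A : OpportunisticScheduling.Algorithm U),
        ∃ q : unitInterval, (q : ℝ) ∈ Set.Icc (1 / 4 : ℝ) (3 / 4) ∧
          ∀ T : ℕ, 1 ≤ T →
            A.performance ν q T ≤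
              OpportunisticScheduling.optimalUtility q - c * (Real.log T / T)) ∧
    (∀ (U : Type*) [MeasurableSpace U] (ν : Measure U) [IsProbabilityMeasure ν]
      (A : OpportunisticScheduling.Algorithm U),
      ∃ Q : Set ℝ, MeasurableSet Q ∧ Q ⊆ Set.Icc (1 / 4 : ℝ) (3 / 4) ∧
        ENNReal.ofReal (1 / 6) ≤ volume Q ∧
        ∀ q : unitInterval, (q : ℝ) ∈ Q →
          ((3 * (2 / 3 - √7 / 6) ^ 2 / 2 ^ 13 : ℝ) : EReal) ≤
            limsup (fun T : ℕ =>
              (((T * OpportunisticScheduling.optimalUtility q - T * A.performance ν q T)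
                / Real.log T : ℝ) : EReal)) atTop) := by
  -- The crude bounds 2 ≤ √7 ≤ 4 give 0 ≤ β ≤ 1/3, so 3β²/2¹³ ≤ 1/24576, below the constant 1/20480
  -- obtained here.
  have hβ : (3 * (2 / 3 - √7 / 6) ^ 2 / 2 ^ 13 : ℝ) ≤ 1 / 5 * (1 / 4096) := by
    have h1 : 2 ≤ √7 := Real.le_sqrt_of_sq_le (by norm_num)
    have h2 : √7 ≤ 4 := Real.sqrt_le_iff.2 (by norm_num)
    nlinarith
  refine ⟨⟨1 / 5 * (1 / 15552), by norm_num, fun U _ ν _ A => ?_⟩, fun U _ ν _ A => ?_⟩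
  · obtain ⟨q, hq, hsum⟩ := (A.twoPointBound_risk ν).exists_log_le_sum
      fun t q hq => A.risk_nonneg ν t hq
    refine ⟨⟨q, by linarith [hq.1], by linarith [hq.2]⟩, hq, fun T hT => ?_⟩
    have h1 := hsum T hT
    have h2 := A.sum_risk_le ν (q := ⟨q, by linarith [hq.1], by linarith [hq.2]⟩) hq hT
    have hT0 : (0 : ℝ) < T := by exact_mod_cast hT
    rw [← mul_sub] at h2
    have h3 : 1 / 5 * (1 / 15552) * (Real.log T / T) * T = 1 / 5 * (1 / 15552 * Real.log T) := by
      field_simp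
    have h4 := le_of_mul_le_mul_right (h3.le.trans ((mul_le_mul_of_nonneg_left h1
      (by norm_num)).trans (h2.trans_eq (mul_comm _ _)))) hT0
    linarith
  · obtain ⟨Q, hQm, hQI, hQv, hQ⟩ := (A.twoPointBound_risk ν).exists_frequently_log_le_sum
      (A.measurable_risk ν) (fun t q hq => A.risk_nonneg ν t hq) (A.integrableOn_risk ν)
    refine ⟨Q, hQm, hQI, hQv, fun q hq => le_limsup_of_frequently_le' ?_⟩
    refine ((hQ q hq).and_eventually (eventually_ge_atTop 2)).mono fun T hT => ?_
    obtain ⟨h1, hT2⟩ := hT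
    have hlog : 0 < Real.log T := Real.log_pos (by exact_mod_cast hT2)
    have h2 := A.sum_risk_le ν (hQI hq) (by omega : 1 ≤ T)
    refine EReal.coe_le_coe_iff.2 (hβ.trans ?_)
    rw [le_div_iff₀ hlog]
    linarith
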